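/- For a real number $r \ge 1$ let $C^r$ be the circle of circumference $r$ with its arc-length distance $d_r$ (the length of a shorter arc), and let $\bar x$ be the point of $C^r$ antipodal to $x$. For a finite simple graph $G$, the circular chromatic number $\chi_c(G)$ is the infimum of all $r \ge 1$ for which there is a map $f : V(G) \to C^r$ with $d_r(f(u), f(v)) \ge 1$ for every edge $uv$. For a signature $\sigma : E(G) \to \{+,-\}$, the number $\chi_c(G,\sigma)$ is the infimum of all $r \ge 1$ for which there is a map $f : V(G) \to C^r$ with $d_r(f(u), f(v)) \ge 1$ for every positive edge $uv$ and $d_r(f(u), \overline{f(v)}) \ge 1$ for every negative edge $uv$. The signed circular chromatic number of $G$ is $\chi_c^s(G) = \max_\sigma \chi_c(G,\sigma)$, the maximum being over all signatures $\sigma$ of $G$. Theorem. For all integers $k, g \ge 2$ and every real $\varepsilon > 0$ there is a finite simple graph $G$ of girth at least $g$ (acyclic graphs having infinite girth) with chromatic number $\chi(G) = k$ and $$\chi_c^s(G) > 2k - \varepsilon .$$ Moreover, for this graph $$2\chi_c(G) - \varepsilon < \chi_c^s(G) \le 2\chi_c(G),$$ so that the bound $\chi_c^s \le 2\chi_c$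 is asymptotically tight even among graphs of large girth. -/

import Mathlib

/-- The antipodal of a point `x` of the circle `AddCircle r` of circumference `r`: the unique point
at distance `r / 2` from `x` (for `r > 0`). -/
noncomputable def antipodal {r : ℝ} (x : AddCircle r) : AddCircle r :=
  x + ((r / 2 : ℝ) : AddCircle r)

/-- A circular `r`-coloring of a graph: the ends of every edge receive points at distance at
least `1` on the circle of circumference `r`. The distance of `AddCircle r` is the length of a
shorter arc. -/
def IsCircularColoring {V : Type*} (G : SimpleGraph V) (r : ℝ) (f : V → AddCircle r) : Prop :=
  ∀ u v : V, G.Adj u v → 1 ≤ dist (f u) (f v)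

/-- The circular chromatic number of a graph. -/
noncomputable def circularChromaticNumber {V : Type*} (G : SimpleGraph V) : ℝ :=
  sInf {r : ℝ | 1 ≤ r ∧ ∃ f : V → AddCircle r, IsCircularColoring G r f}

/-- A signature of a simple graph gives each edge the sign `+` (the unit `1` of `ℤ`) or
`-` (the unit `-1`). -/
abbrev Signature {V : Type*} (G : SimpleGraph V) : Type _ := G.edgeSet → ℤˣ

/-- A circular `r`-coloring of the signed graph `(G, σ)`. -/
def IsSignedCircularColoring {V : Type*} (G : SimpleGraph V) (σ : Signature G) (r : ℝ)
    (f : V → AddCircle r) : Prop :=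
  ∀ (u v : V) (h : G.Adj u v),
    (σ ⟨s(u, v), h⟩ = 1 → 1 ≤ dist (f u) (f v)) ∧
    (σ ⟨s(u, v), h⟩ = -1 → 1 ≤ dist (f u) (antipodal (f v)))

/-- The circular chromatic number `χ_c(G, σ)` of the signed graph `(G, σ)`. -/
noncomputable def signedGraphCircularChromaticNumber {V : Type*} (G : SimpleGraph V)
    (σ : Signature G) : ℝ :=
  sInf {r : ℝ | 1 ≤ r ∧ ∃ f : V → AddCircle r, IsSignedCircularColoring G σ r f}

/-- The signed circular chromatic number `χ_c^s(G)` of a finite simple graph: the largest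
`χ_c(G, σ)` over all signatures `σ` of `G`; the supremum is attained, see
`isGreatest_signedCircularChromaticNumber`. -/
noncomputable def signedCircularChromaticNumber {V : Type*} [Finite V]
    (G : SimpleGraph V) : ℝ :=
  ⨆ σ : Signature G, signedGraphCircularChromaticNumber G σ

/-- The supremum over the signatures is a maximum. -/
theorem isGreatest_signedCircularChromaticNumber {V : Type*} [Finite V] (G : SimpleGraph V) :
    IsGreatest (Set.range fun σ : Signature G => signedGraphCircularChromaticNumber G σ)
      (signedCircularChromaticNumber G) :=
  ⟨(Set.range_nonempty _).csSup_mem (Set.finite_range _),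
    fun _ hx => le_csSup (Set.finite_range _).bddAbove hx⟩

/-!
The upper bound `χ_c^s(G) ≤ 2 χ_c(G)` comes from unrolling a circular `r`-colouring onto the circle
of circumference `2 * r`: a point there and its antipode lie over the same point of the smaller
circle, so both stay at distance at least `1` from the colours of all neighbours
(`IsCircularColoring.exists_isSignedCircularColoring`). Since `χ_c(G) ≤ χ(G)`, everything else
follows once there is a `k`-colourable graph of large girth with `2 * k - ε < χ_c^s(G)`.

On a circle of circumference `r < 2 * k`, identify antipodes. The quotient has circumference less
than `k`, so among any `k` points of it two are at distance less than `1`, and an edge of a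
suitable sign between vertices with these colours is violated
(`exists_ne_not_discreteSignedConstraint`). Hence, whatever the colouring of a complete `k`-partite
graph with parts of size `p`, a constant proportion of its signed edges is violated. After rounding
the colours to a fine grid there are only `M ^ (k * p)` colourings, and a sparse graph can violate
all of them: edges are inserted one by one, each chosen by averaging so as to violate a constant
proportion of the colourings not violated so far (`IsGreedyStage.exists_step`). A number of edges
linear in `p` suffices, so the degrees can be kept bounded, and then only `O(p)` pairs of vertices
are too close to be joined without creating a short cycle. For large `p` this restriction costs
little, and the resulting graph has large girth (`exists_labelled_graph_of_large_girth`).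
-/

/-! ### Short cycles and short walks -/

/-- A cycle through a new edge `uv` becomes, without that edge, a walk from `u` to `v`. So the
girth bound survives the insertion of `uv` when `u` and `v` are far apart. -/
theorem SimpleGraph.le_egirth_sup_edge {V : Type*} {G : SimpleGraph V} {u v : V} {g : ℕ}
    (hG : (g : ℕ∞) ≤ G.egirth) (huv : ∀ p : G.Walk u v, g < p.length) :
    (g : ℕ∞) ≤ (G ⊔ SimpleGraph.edge u v).egirth := by
  classical
  rw [SimpleGraph.le_egirth] at hG ⊢
  intro a c hc
  have key : ∀ {x y : V} (q : (G ⊔ SimpleGraph.edge u v).Walk x y), s(u, v) ∉ q.edges →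
      ∀ e ∈ q.edges, e ∈ G.edgeSet := by
    intro x y q hq e he
    have h := q.edges_subset_edgeSet he
    induction e with | _ b d => ?_
    rw [SimpleGraph.mem_edgeSet, SimpleGraph.sup_adj, SimpleGraph.edge_adj] at h
    rcases h with h | ⟨⟨rfl, rfl⟩ | ⟨rfl, rfl⟩, -⟩
    · exact h
    · exact absurd he hq
    · exact absurd (Sym2.eq_swap ▸ he) hq
  by_cases he : s(u, v) ∈ c.edges
  · have hu : u ∈ c.support := c.fst_mem_support_of_mem_edges he
    have hc' : (c.rotate u hu).IsCycle := hc.rotate hu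
    have hlen : (c.rotate u hu).length = c.length := SimpleGraph.Walk.length_rotate _ _ _
    have he' : s(u, v) ∈ (c.rotate u hu).edges := (c.rotate_edges u hu).mem_iff.mpr he
    generalize c.rotate u hu = c' at hc' hlen he'
    have hv : v ∈ c'.support := c'.snd_mem_support_of_mem_edges he'
    have hdis := hc'.isCircuit.isTrail.disjoint_edges_takeUntil_dropUntil hv
    have hsum : (c'.takeUntil v hv).length + (c'.dropUntil v hv).length = c'.length := by
      rw [← SimpleGraph.Walk.length_append, SimpleGraph.Walk.take_spec]
    by_cases h1 : s(u, v) ∈ (c'.takeUntil v hv).edges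
    · have h2 : s(u, v) ∉ (c'.dropUntil v hv).edges := fun h => hdis h1 h
      have := huv (((c'.dropUntil v hv).transfer G (key _ h2)).reverse)
      rw [SimpleGraph.Walk.length_reverse, SimpleGraph.Walk.length_transfer] at this
      exact_mod_cast (by omega : g ≤ c.length)
    · have := huv ((c'.takeUntil v hv).transfer G (key _ h1))
      rw [SimpleGraph.Walk.length_transfer] at this
      exact_mod_cast (by omega : g ≤ c.length)
  · simpa using hG a (c.transfer G (key _ he)) (hc.transfer _)

/-- In a graph of maximum degree at most `D`, at most `(D + 1) ^ m` vertices can be reached from a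
given vertex by walks of length at most `m`. -/
theorem SimpleGraph.exists_finset_walk_length_le {V : Type*} [Finite V] (G : SimpleGraph V)
    {D : ℕ} (hD : ∀ w, (G.neighborSet w).ncard ≤ D) (m : ℕ) (u : V) :
    ∃ T : Finset V, T.card ≤ (D + 1) ^ m ∧
      ∀ (v : V) (p : G.Walk u v), p.length ≤ m → v ∈ T := by
  classical
  induction m generalizing u with
  | zero =>
    refine ⟨{u}, by simp, fun v p hp => ?_⟩
    simpa using (SimpleGraph.Walk.eq_of_length_eq_zero (Nat.le_zero.mp hp)).symm
  | succ m ih =>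
    choose T hT hmem using ih
    have hfin := (G.neighborSet u).toFinite
    refine ⟨{u} ∪ hfin.toFinset.biUnion T, ?_, fun v p hp => ?_⟩
    · calc _ ≤ 1 + hfin.toFinset.card * (D + 1) ^ m :=
            (Finset.card_union_le _ _).trans (Nat.add_le_add (by simp)
              (Finset.card_biUnion_le_card_mul _ _ _ fun w _ => hT w))
        _ ≤ (D + 1) ^ m + D * (D + 1) ^ m := by
            refine Nat.add_le_add (Nat.one_le_pow _ _ (by omega)) (Nat.mul_le_mul_right _ ?_)
            rw [← Set.ncard_eq_toFinset_card _ hfin]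
            exact hD u
        _ = (D + 1) ^ (m + 1) := by ring
    · cases p with
      | nil => simp
      | @cons _ w _ h q =>
        rw [SimpleGraph.Walk.length_cons] at hp
        simp only [Finset.mem_union, Finset.mem_biUnion, Set.Finite.mem_toFinset]
        exact Or.inr ⟨w, h, hmem w v q (by omega)⟩

/-! ### Sparse edge-labelled multipartite graphs without compatible colourings -/

/-- `f` is a colouring of the graph `G`, with edges labelled by `l`, that respects the relation
`ok s a b`: the colours `a`, `b` are allowed at the ends of an edge with label `s`. -/
def IsLabelledColoring {V C S : Type*} (ok : S → C → C → Prop) (G : SimpleGraph V)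
    (l : Sym2 V → S) (f : V → C) : Prop :=
  ∀ u v : V, G.Adj u v → ok (l s(u, v)) (f u) (f v)

/-- If every choice of `k` colours has a forbidden pair, then every colouring of the vertices
`Fin k × ZMod p` has `p ^ 2` forbidden pairs: one on each of the `p ^ 2` lines
`i ↦ a + i * b`, any two of which meet at most once. -/
theorem sq_le_card_forbidden_pairs {k p : ℕ} [Fact p.Prime] (hkp : k ≤ p) {C : Type*}
    (forb : C → C → Prop) (hforb : ∀ c : Fin k → C, ∃ i j, i ≠ j ∧ forb (c i) (c j))
    (f : Fin k × ZMod p → C) (P : Finset ((Fin k × ZMod p) × (Fin k × ZMod p)))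
    (hP : ∀ u v, u.1 ≠ v.1 → forb (f u) (f v) → (u, v) ∈ P) :
    p ^ 2 ≤ P.card := by
  choose i j hij hb using fun x : ZMod p × ZMod p => hforb fun m => f (m, x.1 + m.val * x.2)
  have hinj : ∀ m m' : Fin k, (m.val : ZMod p) = m'.val → m = m' := by
    intro m m' h
    rw [ZMod.natCast_eq_natCast_iff', Nat.mod_eq_of_lt (by omega), Nat.mod_eq_of_lt (by omega)] at h
    exact Fin.ext h
  have hcard : (Finset.univ : Finset (ZMod p × ZMod p)).card = p ^ 2 := by
    rw [Finset.card_univ, Fintype.card_prod, ZMod.card, sq]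
  rw [← hcard]
  refine Finset.card_le_card_of_injOn
    (fun x => ((i x, x.1 + (i x).val * x.2), (j x, x.1 + (j x).val * x.2)))
    (fun x _ => hP _ _ (hij x) (hb x)) fun x _ y _ hxy => ?_
  simp only [Prod.mk.injEq] at hxy
  obtain ⟨⟨h1, h2⟩, h3, h4⟩ := hxy
  rw [← h1] at h2
  rw [← h3] at h4
  have hne : ((i x).val : ZMod p) - (j x).val ≠ 0 := fun h => hij x (hinj _ _ (sub_eq_zero.mp h))
  have hsnd : x.2 = y.2 := mul_left_cancel₀ hne (by linear_combination h2 - h4)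
  rw [hsnd] at h2
  exact Prod.ext (add_right_cancel h2) hsnd

/-- A stage of the greedy construction: a labelled `k`-partite graph on `Fin k × ZMod p`, of girth
at least `g` and maximum degree at most `D`, with at most `t` edges. The last two conditions are
imposed on an upper bound `d` for the degrees, which is simpler to update than the degrees. -/
structure IsGreedyStage {k p : ℕ} (g D t : ℕ) (G : SimpleGraph (Fin k × ZMod p)) [NeZero p]
    (d : Fin k × ZMod p → ℕ) : Prop where
  fst_ne : ∀ u v, G.Adj u v → u.1 ≠ v.1
  le_egirth : (g : ℕ∞) ≤ G.egirth
  ncard_le : ∀ w, (G.neighborSet w).ncard ≤ d w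
  le_maxDegree : ∀ w, d w ≤ D
  sum_le : ∑ w, d w ≤ 2 * t

theorem IsGreedyStage.sup_edge {k p : ℕ} [NeZero p] {g D t : ℕ}
    {G : SimpleGraph (Fin k × ZMod p)} {d : Fin k × ZMod p → ℕ} (hG : IsGreedyStage g D t G d)
    {u v : Fin k × ZMod p} (huv : u.1 ≠ v.1) (hu : d u < D) (hv : d v < D)
    (hfar : ∀ q : G.Walk u v, g < q.length) :
    IsGreedyStage g D (t + 1) (G ⊔ SimpleGraph.edge u v)
      (fun w => d w + ((if w = u then 1 else 0) + if w = v then 1 else 0)) where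
  fst_ne x y hxy := by
    rw [SimpleGraph.sup_adj, SimpleGraph.edge_adj] at hxy
    rcases hxy with h | ⟨⟨rfl, rfl⟩ | ⟨rfl, rfl⟩, -⟩
    exacts [hG.fst_ne _ _ h, huv, huv.symm]
  le_egirth := SimpleGraph.le_egirth_sup_edge hG.le_egirth hfar
  ncard_le w := by
    have hne : u ≠ v := fun h => huv (congrArg _ h)
    have hle : ∀ x, (∀ y, (G ⊔ SimpleGraph.edge u v).Adj w y → G.Adj w y ∨ y = x) →
        ((G ⊔ SimpleGraph.edge u v).neighborSet w).ncard ≤ d w + 1 := fun x hx => by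
      refine (Set.ncard_le_ncard (t := insert x (G.neighborSet w)) fun y hy => ?_).trans
        ((Set.ncard_insert_le _ _).trans (Nat.add_le_add_right (hG.ncard_le w) 1))
      exact (hx y hy).symm
    by_cases hwu : w = u
    · subst hwu
      simpa [hne] using hle v fun y hy => by
        rw [SimpleGraph.sup_adj, SimpleGraph.edge_adj] at hy
        tauto
    by_cases hwv : w = v
    · subst hwv
      simpa [hne.symm] using hle u fun y hy => by
        rw [SimpleGraph.sup_adj, SimpleGraph.edge_adj] at hy
        tauto
    refine (Set.ncard_le_ncard fun y hy => ?_).trans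
      ((hG.ncard_le w).trans (Nat.le_add_right _ _))
    rw [SimpleGraph.mem_neighborSet, SimpleGraph.sup_adj, SimpleGraph.edge_adj] at hy
    rw [SimpleGraph.mem_neighborSet]
    tauto
  le_maxDegree w := by
    have hne : u ≠ v := fun h => huv (congrArg _ h)
    have := hG.le_maxDegree w
    by_cases hwu : w = u
    · subst hwu
      simp [hne]; omega
    by_cases hwv : w = v
    · subst hwv
      simp [hwu]; omega
    simpa [hwu, hwv] using this
  sum_le := by
    have := hG.sum_le
    rw [Finset.sum_add_distrib, Finset.sum_add_distrib]
    simp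
    omega

/-- At a stage with few edges, almost all pairs of vertices in different parts may still be joined
by an edge: the exceptions `X` come from the vertices of full degree and from the pairs of vertices
at a short distance. The degree bound `16 * A * k` leaves at most `p / (8 * k)` full vertices after
`A * p` edges, which accounts for `p ^ 2 / 4` exceptions; the lower bound on `p` gives as many for
the short distances. -/
theorem IsGreedyStage.exists_small_exceptions {k p : ℕ} [NeZero p] {g A t : ℕ}
    (hA : 0 < A) (ht : t < A * p) (hp : 4 * k * (16 * A * k + 1) ^ g ≤ p)
    {G : SimpleGraph (Fin k × ZMod p)} {d : Fin k × ZMod p → ℕ}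
    (hG : IsGreedyStage g (16 * A * k) t G d) :
    ∃ X : Finset ((Fin k × ZMod p) × (Fin k × ZMod p)), 2 * X.card ≤ p ^ 2 ∧
      ∀ u v, (u, v) ∉ X →
        d u < 16 * A * k ∧ d v < 16 * A * k ∧ ∀ q : G.Walk u v, g < q.length := by
  classical
  set D := 16 * A * k with hD
  choose T hT hmem using
    G.exists_finset_walk_length_le (fun w => (hG.ncard_le w).trans (hG.le_maxDegree w)) g
  set F : Finset (Fin k × ZMod p) := Finset.univ.filter fun w => D ≤ d w with hF
  have hV : Fintype.card (Fin k × ZMod p) = k * p := by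
    rw [Fintype.card_prod, ZMod.card, Fintype.card_fin]
  have hFD : F.card * D ≤ 2 * t := by
    refine le_trans ?_ hG.sum_le
    rw [← smul_eq_mul]
    exact (Finset.card_nsmul_le_sum F d D fun w hw => (Finset.mem_filter.mp hw).2).trans
      (Finset.sum_le_univ_sum_of_nonneg fun _ => Nat.zero_le _)
  have hF8 : F.card * (8 * k) ≤ p := by
    refine le_of_mul_le_mul_left (a := 2 * A) ?_ (by omega)
    calc 2 * A * (F.card * (8 * k)) = F.card * D := by rw [hD]; ring
      _ ≤ 2 * (A * p) := hFD.trans (by omega)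
      _ = 2 * A * p := by ring
  refine ⟨(F ×ˢ Finset.univ) ∪ (Finset.univ ×ˢ F) ∪
    ((Finset.univ : Finset (Fin k × ZMod p)).biUnion fun u => {u} ×ˢ T u), ?_, ?_⟩
  · have hX : ((F ×ˢ Finset.univ) ∪ (Finset.univ ×ˢ F) ∪
        ((Finset.univ : Finset (Fin k × ZMod p)).biUnion fun u => {u} ×ˢ T u)).card ≤
        F.card * (k * p) + k * p * F.card + k * p * (D + 1) ^ g := by
      refine (Finset.card_union_le _ _).trans (Nat.add_le_add ?_ ?_)
      · refine (Finset.card_union_le _ _).trans_eq ?_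
        rw [Finset.card_product, Finset.card_product, Finset.card_univ, hV]
      · rw [← hV, ← Finset.card_univ]
        refine Finset.card_biUnion_le_card_mul _ _ _ fun u _ => ?_
        rw [Finset.card_product, Finset.card_singleton, one_mul]
        exact hT u
    have h1 := Nat.mul_le_mul_right p hF8
    have h2 := Nat.mul_le_mul_right p hp
    nlinarith
  · intro u v huv
    simp only [Finset.mem_union, Finset.mem_product, Finset.mem_univ, and_true, true_and, hF,
      Finset.mem_filter, Finset.mem_biUnion, Finset.mem_singleton, not_or, not_le] at huv
    refine ⟨huv.1.1, huv.1.2, fun q => ?_⟩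
    by_contra! hq
    exact huv.2 ⟨u, rfl, hmem u v q hq⟩

open Classical in
/-- One step of the greedy construction. Averaging over all insertable labelled edges, of which
there are at most `(k * p) ^ 2 * card S`, one of them destroys at least one in
`2 * k ^ 2 * card S` of the surviving colourings, because each of these colourings is destroyed by
at least `p ^ 2 / 2` insertable edges. -/
theorem IsGreedyStage.exists_step {k p : ℕ} [Fact p.Prime] {C S : Type*} [Fintype C] [Fintype S]
    {ok : S → C → C → Prop} (hok : ∀ c : Fin k → C, ∃ i j, i ≠ j ∧ ∃ s, ¬ ok s (c i) (c j))
    {g A t : ℕ} (hg : 0 < g) (hA : 0 < A) (ht : t < A * p) (hkp : k ≤ p)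
    (hp : 4 * k * (16 * A * k + 1) ^ g ≤ p)
    {G : SimpleGraph (Fin k × ZMod p)} {d : Fin k × ZMod p → ℕ}
    (hG : IsGreedyStage g (16 * A * k) t G d) (l : Sym2 (Fin k × ZMod p) → S) :
    ∃ G' d' l', IsGreedyStage g (16 * A * k) (t + 1) G' d' ∧
      2 * k ^ 2 * Fintype.card S *
          (Finset.univ.filter fun f : Fin k × ZMod p → C => IsLabelledColoring ok G' l' f).card ≤
        (2 * k ^ 2 * Fintype.card S - 1) *
          (Finset.univ.filter fun f : Fin k × ZMod p → C => IsLabelledColoring ok G l f).card := by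
  set N := Finset.univ.filter fun f : Fin k × ZMod p → C => IsLabelledColoring ok G l f with hN
  set Q := 2 * k ^ 2 * Fintype.card S with hQ
  rcases N.eq_empty_or_nonempty with hN0 | ⟨f₀, hf₀⟩
  · exact ⟨G, d, l, ⟨hG.fst_ne, hG.le_egirth, hG.ncard_le, hG.le_maxDegree,
      hG.sum_le.trans (by omega)⟩, by rw [← hN, hN0]; simp⟩
  obtain ⟨X, hX, hfree⟩ := hG.exists_small_exceptions hA ht hp
  set O := Finset.univ.filter fun o : (Fin k × ZMod p) × (Fin k × ZMod p) × S =>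
    o.1.1 ≠ o.2.1.1 ∧ (o.1, o.2.1) ∉ X with hO
  let kills : (Fin k × ZMod p) × (Fin k × ZMod p) × S → (Fin k × ZMod p → C) → Prop :=
    fun o f => ¬ ok o.2.2 (f o.1) (f o.2.1)
  have hp0 : 0 < p := (Fact.out : p.Prime).pos
  have hmany : ∀ f ∈ N, p ^ 2 ≤ 2 * (O.bipartiteBelow kills f).card := by
    intro f _
    have h1 := sq_le_card_forbidden_pairs hkp (fun a b => ∃ s, ¬ ok s a b) hok f
      ((O.bipartiteBelow kills f).image (fun o => (o.1, o.2.1)) ∪ X) fun u v huv ⟨s, hs⟩ => by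
        by_cases hx : (u, v) ∈ X
        · exact Finset.mem_union_right _ hx
        · refine Finset.mem_union_left _ (Finset.mem_image.mpr ⟨(u, v, s), ?_, rfl⟩)
          simp only [Finset.mem_bipartiteBelow, hO, Finset.mem_filter, Finset.mem_univ, true_and]
          exact ⟨⟨huv, hx⟩, hs⟩
    have h2 := Finset.card_union_le
      ((O.bipartiteBelow kills f).image fun o => (o.1, o.2.1)) X
    have h3 := Finset.card_image_le (s := O.bipartiteBelow kills f) (f := fun o => (o.1, o.2.1))
    omega
  have hOne : O.Nonempty := by
    by_contra h
    have h1 := hmany f₀ hf₀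
    rw [Finset.not_nonempty_iff_eq_empty.mp h] at h1
    have : 0 < p ^ 2 := by positivity
    simp [Finset.bipartiteBelow] at h1
    omega
  have hOcard : O.card ≤ (k * p) ^ 2 * Fintype.card S := by
    refine (Finset.card_le_univ O).trans_eq ?_
    simp only [Fintype.card_prod, ZMod.card, Fintype.card_fin]
    ring
  obtain ⟨⟨u, v, s⟩, ho, hkill⟩ : ∃ o ∈ O, N.card ≤ Q * (N.bipartiteAbove kills o).card := by
    by_contra! h
    have h1 := Finset.sum_lt_sum_of_nonempty hOne h
    rw [← Finset.mul_sum, Finset.sum_card_bipartiteAbove_eq_sum_card_bipartiteBelow,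
      Finset.sum_const, smul_eq_mul] at h1
    have h2 := Finset.card_nsmul_le_sum N _ _ hmany
    rw [← Finset.mul_sum, smul_eq_mul] at h2
    have h3 := Nat.mul_le_mul_left (k ^ 2 * Fintype.card S) h2
    have h4 := Nat.mul_le_mul_right N.card hOcard
    rw [hQ] at h1
    nlinarith
  simp only [hO, Finset.mem_filter, Finset.mem_univ, true_and] at ho
  obtain ⟨huv, hx⟩ := ho
  obtain ⟨hu, hv, hfar⟩ := hfree u v hx
  refine ⟨_, _, Function.update l s(u, v) s, hG.sup_edge huv hu hv hfar, ?_⟩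
  -- the new label overwrites none of the labels in use
  have hadj : ¬ G.Adj u v := fun h => by
    have := hfar h.toWalk
    simp at this
    omega
  have hsub : (Finset.univ.filter fun f : Fin k × ZMod p → C =>
      IsLabelledColoring ok (G ⊔ SimpleGraph.edge u v) (Function.update l s(u, v) s) f) ⊆
      N \ N.bipartiteAbove kills (u, v, s) := by
    intro f hf
    simp only [Finset.mem_filter, Finset.mem_univ, true_and] at hf
    simp only [Finset.mem_sdiff, Finset.mem_bipartiteAbove, hN, Finset.mem_filter,
      Finset.mem_univ, true_and, kills, not_and, not_not]
    refine ⟨fun x y hxy => ?_, fun _ => ?_⟩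
    · have h := hf x y (Or.inl hxy)
      rwa [Function.update_of_ne] at h
      intro h'
      exact hadj (by rwa [← SimpleGraph.mem_edgeSet, ← h'])
    · have h := hf u v (Or.inr (by
        rw [SimpleGraph.edge_adj]; exact ⟨Or.inl ⟨rfl, rfl⟩, fun h => huv (congrArg _ h)⟩))
      rwa [Function.update_self] at h
  have h1 := Finset.card_le_card hsub
  have h2 := Finset.card_sdiff_add_card_eq_card
    (show N.bipartiteAbove kills (u, v, s) ⊆ N from Finset.filter_subset _ _)
  calc _ ≤ Q * (N.card - (N.bipartiteAbove kills (u, v, s)).card) :=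
        Nat.mul_le_mul_left _ (by omega)
    _ = Q * N.card - Q * (N.bipartiteAbove kills (u, v, s)).card := Nat.mul_sub _ _ _
    _ ≤ Q * N.card - N.card := Nat.sub_le_sub_left hkill _
    _ = (Q - 1) * N.card := by rw [Nat.sub_mul, one_mul]

/-- If every choice of `k` colours contains a pair forbidden for some label, then there is a finite
labelled `k`-colourable graph of large girth no colouring of which respects the labels. -/
theorem exists_labelled_graph_of_large_girth {k : ℕ} (hk : 0 < k) (g : ℕ) {C S : Type*}
    [Finite C] [Nonempty C] [Finite S] (ok : S → C → C → Prop)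
    (hok : ∀ c : Fin k → C, ∃ i j, i ≠ j ∧ ∃ s, ¬ ok s (c i) (c j)) :
    ∃ (V : Type) (_ : Fintype V) (G : SimpleGraph V) (l : Sym2 V → S),
      (g : ℕ∞) ≤ G.egirth ∧ G.Colorable k ∧ ∀ f : V → C, ¬ IsLabelledColoring ok G l f := by
  classical
  have := Fintype.ofFinite C
  have := Fintype.ofFinite S
  obtain ⟨_, _, _, s₀, _⟩ := hok fun _ => Classical.arbitrary C
  set Q := 2 * k ^ 2 * Fintype.card S with hQ
  have hQ0 : 0 < Q := by
    have := Fintype.card_pos_iff.mpr ⟨s₀⟩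
    positivity
  -- `A * p` steps of the construction suffice to destroy all colourings
  obtain ⟨A, hA, hpow⟩ : ∃ A, 0 < A ∧ (Q - 1) ^ A * Fintype.card C ^ k < Q ^ A := by
    have hlim : Filter.Tendsto (fun n : ℕ => (((Q - 1 : ℕ) : ℝ) / Q) ^ n * Fintype.card C ^ k)
        Filter.atTop (nhds (0 * Fintype.card C ^ k)) := by
      refine (tendsto_pow_atTop_nhds_zero_of_lt_one (by positivity) ?_).mul_const _
      rw [div_lt_one (by positivity)]
      exact_mod_cast Nat.sub_lt hQ0 one_pos
    rw [zero_mul] at hlim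
    obtain ⟨A, h1, h2⟩ :=
      ((hlim.eventually (gt_mem_nhds one_pos)).and (Filter.eventually_gt_atTop 0)).exists
    refine ⟨A, h2, ?_⟩
    rw [div_pow, div_mul_eq_mul_div, div_lt_one (by positivity)] at h1
    exact_mod_cast h1
  -- a prime exceeding both lower bounds that a single step needs
  obtain ⟨p, hp, hpp⟩ := Nat.exists_infinite_primes (k + 4 * k * (16 * A * k + 1) ^ (g + 1))
  have : Fact p.Prime := ⟨hpp⟩
  have stage : ∀ t ≤ A * p, ∃ G d, ∃ l : Sym2 (Fin k × ZMod p) → S,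
      IsGreedyStage (g + 1) (16 * A * k) t G d ∧
      Q ^ t * (Finset.univ.filter fun f : Fin k × ZMod p → C => IsLabelledColoring ok G l f).card ≤
        (Q - 1) ^ t * Fintype.card C ^ (k * p) := by
    intro t ht
    induction t with
    | zero =>
      refine ⟨⊥, 0, fun _ => s₀, ⟨by simp, by simp, by simp, by simp, by simp⟩, ?_⟩
      rw [pow_zero, pow_zero, one_mul, one_mul]
      refine (Finset.card_le_univ _).trans_eq ?_
      rw [Fintype.card_fun, Fintype.card_prod, ZMod.card, Fintype.card_fin]
    | succ t ih =>
      obtain ⟨G, d, l, hG, hcard⟩ := ih (by omega)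
      obtain ⟨G', d', l', hG', hcard'⟩ :=
        hG.exists_step hok (Nat.succ_pos g) hA ht (le_trans (Nat.le_add_right _ _) hp)
          (le_trans (Nat.le_add_left _ _) hp) l
      refine ⟨G', d', l', hG', ?_⟩
      rw [pow_succ Q, mul_assoc]
      refine (Nat.mul_le_mul_left _ hcard').trans ?_
      rw [mul_left_comm, pow_succ' (Q - 1), mul_assoc (Q - 1)]
      exact Nat.mul_le_mul_left _ hcard
  obtain ⟨G, d, l, hG, hcard⟩ := stage (A * p) le_rfl
  refine ⟨Fin k × ZMod p, inferInstance, G, l, ?_,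
    ⟨SimpleGraph.Coloring.mk Prod.fst fun {u v} h => hG.fst_ne u v h⟩, fun f hf => ?_⟩
  · exact le_trans (by exact_mod_cast Nat.le_succ g) hG.le_egirth
  · have hpos : 1 ≤ (Finset.univ.filter
        fun f : Fin k × ZMod p → C => IsLabelledColoring ok G l f).card :=
      Finset.card_pos.mpr ⟨f, by simpa using hf⟩
    have h1 : Q ^ (A * p) ≤ (Q - 1) ^ (A * p) * Fintype.card C ^ (k * p) :=
      (Nat.le_mul_of_pos_right _ hpos).trans hcard
    rw [pow_mul, pow_mul, pow_mul, ← mul_pow] at h1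
    exact absurd h1 (not_le.mpr (Nat.pow_lt_pow_left hpow hpp.ne_zero))

/-! ### Points on the circle -/

/-- Among `k ≥ 2` points of a circle of circumference `1`, two are at distance at most `1 / k`. -/
theorem exists_ne_abs_sub_sub_intCast_le {k : ℕ} (hk : 2 ≤ k) (x : Fin k → ℝ) :
    ∃ i j, i ≠ j ∧ ∃ n : ℤ, |x i - x j - n| ≤ 1 / k := by
  have hk0 : (0 : ℝ) < k := by positivity
  have hk2 : (2 : ℝ) ≤ k := by exact_mod_cast hk
  let o : Fin k := ⟨0, by omega⟩
  -- rotate so that the point with index `o` is the origin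
  set z : Fin k → ℝ := fun i => Int.fract (x i - x o) with hz
  have hzx : ∀ i, x i = z i + x o + ⌊x i - x o⌋ := fun i => by
    have := Int.fract_add_floor (x i - x o)
    simp only [hz]
    linarith
  have hzo : z o = 0 := by simp [hz]
  by_cases h : ∃ i, (k : ℝ) - 1 ≤ k * z i
  · -- a point in the last of `k` equal arcs is close to the origin
    obtain ⟨i, hi⟩ := h
    refine ⟨i, o, fun h => ?_, ⌊x i - x o⌋ + 1, ?_⟩
    · rw [h, hzo] at hi
      linarith
    · have h1 : z i < 1 := Int.fract_lt_one _
      rw [abs_le, le_div_iff₀ hk0, ← neg_div, div_le_iff₀ hk0]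
      push_cast
      rw [show x i - x o - (⌊x i - x o⌋ + 1) = z i - 1 by linarith [hzx i]]
      constructor <;> nlinarith
  · -- otherwise two points lie in the same of the remaining `k - 1` arcs
    push Not at h
    obtain ⟨i, -, j, -, hij, hfl⟩ := Finset.exists_ne_map_eq_of_card_lt_of_maps_to
      (s := (Finset.univ : Finset (Fin k))) (t := Finset.range (k - 1))
      (f := fun i => ⌊k * z i⌋₊) (by simp; omega) fun i _ => by
        rw [Finset.mem_coe, Finset.mem_range, Nat.floor_lt (mul_nonneg hk0.le (Int.fract_nonneg _)),
          Nat.cast_sub (by omega), Nat.cast_one]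
        exact h i
    refine ⟨i, j, hij, ⌊x i - x o⌋ - ⌊x j - x o⌋, ?_⟩
    have hi := Nat.floor_le (mul_nonneg hk0.le (Int.fract_nonneg (x i - x o)))
    have hi' := Nat.lt_floor_add_one (k * z i)
    have hj := Nat.floor_le (mul_nonneg hk0.le (Int.fract_nonneg (x j - x o)))
    have hj' := Nat.lt_floor_add_one (k * z j)
    change _ ≤ k * z i at hi
    change _ ≤ k * z j at hj
    change (⌊k * z i⌋₊ : ℝ) ≤ _ at hi
    change (⌊k * z j⌋₊ : ℝ) ≤ _ at hj
    rw [hfl] at hi hi'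
    push_cast
    rw [show x i - x j - (⌊x i - x o⌋ - ⌊x j - x o⌋ : ℝ) = z i - z j by linarith [hzx i, hzx j],
      abs_le, le_div_iff₀ hk0, ← neg_div, div_le_iff₀ hk0]
    constructor <;> nlinarith

theorem AddCircle.one_le_dist_iff {r : ℝ} (hr : 0 < r) (a b : ℝ) :
    1 ≤ dist (a : AddCircle r) b ↔ ∀ n : ℤ, 1 ≤ |a - b - n * r| := by
  have hscale : ∀ n : ℤ, |a - b - n * r| = r * |r⁻¹ * (a - b) - n| := fun n => by
    rw [← abs_of_pos hr, ← abs_mul, abs_of_pos hr]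
    congr 1
    field_simp
  rw [dist_eq_norm, ← AddCircle.coe_sub]
  refine ⟨fun h n => ?_, fun h => ?_⟩
  · rw [AddCircle.norm_eq' r hr] at h
    rw [hscale]
    exact h.trans (mul_le_mul_of_nonneg_left (round_le _ _) hr.le)
  · rw [AddCircle.norm_eq]
    exact h _

theorem AddCircle.one_le_dist_antipodal_iff {r : ℝ} (hr : 0 < r) (a b : ℝ) :
    1 ≤ dist (a : AddCircle r) (antipodal (b : AddCircle r)) ↔
      ∀ n : ℤ, 1 ≤ |a - b - (n + 1 / 2) * r| := by
  rw [antipodal, ← AddCircle.coe_add, AddCircle.one_le_dist_iff hr]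
  refine forall_congr' fun n => ?_
  rw [show a - (b + r / 2) - n * r = a - b - (n + 1 / 2) * r by ring]

/-! ### The upper bound -/

/-- Unrolling a circular `r`-colouring onto the circle of twice the circumference keeps the ends of
each edge at distance at least `1` and makes each also that far from the antipode of the other.
So it is a colouring for every signature. -/
theorem IsCircularColoring.exists_isSignedCircularColoring {V : Type*} {G : SimpleGraph V} {r : ℝ}
    (hr : 0 < r) {f : V → AddCircle r} (hf : IsCircularColoring G r f) (σ : Signature G) :
    ∃ f' : V → AddCircle (2 * r), IsSignedCircularColoring G σ (2 * r) f' := by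
  choose y hy using fun v => QuotientAddGroup.mk_surjective (f v)
  refine ⟨fun v => (y v : ℝ), fun u v huv => ?_⟩
  have h := hf u v huv
  rw [← hy u, ← hy v] at h
  replace h := (AddCircle.one_le_dist_iff hr _ _).mp h
  rw [AddCircle.one_le_dist_iff (by positivity), AddCircle.one_le_dist_antipodal_iff (by positivity)]
  refine ⟨fun _ n => ?_, fun _ n => ?_⟩
  · convert h (2 * n) using 2
    push_cast
    ring
  · convert h (2 * n + 1) using 2
    push_cast
    ring

theorem SimpleGraph.Colorable.exists_isCircularColoring {V : Type*} {G : SimpleGraph V} {m : ℕ}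
    (hm : 0 < m) (hG : G.Colorable m) : ∃ f : V → AddCircle (m : ℝ), IsCircularColoring G m f := by
  obtain ⟨c⟩ := hG
  refine ⟨fun v => ((c v : ℕ) : ℝ), fun u v huv => ?_⟩
  rw [AddCircle.one_le_dist_iff (by positivity)]
  intro n
  have hne : ((c u : ℕ) : ℤ) - (c v : ℕ) - n * m ≠ 0 := fun h => by
    have hmod : (c u : ℕ) ≡ c v [MOD m] :=
      ((Int.natCast_modEq_iff.mp ((Int.modEq_iff_dvd).mpr ⟨n, by linarith⟩))).symm
    exact c.valid huv (Fin.ext (hmod.eq_of_lt_of_lt (c u).2 (c v).2))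
  exact_mod_cast Int.one_le_abs hne

theorem bddBelow_one_le_and (P : ℝ → Prop) : BddBelow {r : ℝ | 1 ≤ r ∧ P r} := ⟨1, fun _ h => h.1⟩

theorem circularChromaticNumber_le_of_colorable {V : Type*} {G : SimpleGraph V} {m : ℕ}
    (hm : 0 < m) (hG : G.Colorable m) : circularChromaticNumber G ≤ m :=
  csInf_le (bddBelow_one_le_and _) ⟨by exact_mod_cast hm, hG.exists_isCircularColoring hm⟩

theorem signedCircularChromaticNumber_le {V : Type*} [Finite V] (G : SimpleGraph V) {m : ℕ}
    (hm : 0 < m) (hG : G.Colorable m) :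
    signedCircularChromaticNumber G ≤ 2 * circularChromaticNumber G := by
  refine ciSup_le fun σ => ?_
  rw [← div_le_iff₀' two_pos]
  refine le_csInf ⟨m, by exact_mod_cast hm, hG.exists_isCircularColoring hm⟩ ?_
  rintro r ⟨hr, f, hf⟩
  rw [div_le_iff₀' two_pos]
  exact csInf_le (bddBelow_one_le_and _)
    ⟨by linarith, hf.exists_isSignedCircularColoring (by linarith) σ⟩

/-! ### The lower bound -/

/-- The constraint imposed by an edge of sign `s` on colourings by `M` equally spaced points of a
circle, rescaled so that the half turn has length `1`. Even integers `n` then stand for the full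
turns and odd ones for the antipode. -/
def discreteSignedConstraint (k M : ℕ) (s : ℤˣ) (a b : Fin M) : Prop :=
  ∀ n : ℤ, (s = 1 ↔ Even n) → (1 : ℝ) / k < |2 * (a : ℝ) / M - 2 * (b : ℝ) / M - n|

/-- Identifying antipodes, the pigeonhole principle finds two close points among any `k`; the parity
of the number of half turns between them tells which sign forbids the pair. -/
theorem exists_ne_not_discreteSignedConstraint {k : ℕ} (hk : 2 ≤ k) (M : ℕ)
    (c : Fin k → Fin M) :
    ∃ i j, i ≠ j ∧ ∃ s, ¬ discreteSignedConstraint k M s (c i) (c j) := by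
  obtain ⟨i, j, hij, n, hn⟩ :=
    exists_ne_abs_sub_sub_intCast_le hk fun i => 2 * ((c i : ℕ) : ℝ) / M
  refine ⟨i, j, hij, if Even n then 1 else -1, fun h => (h n ?_).not_ge hn⟩
  split_ifs with he <;> simp [he]

/-- Rounding a circular `r`-colouring of a signed graph with `r < 2 * k` down to a sufficiently
fine grid of `M` points. -/
theorem IsSignedCircularColoring.exists_isLabelledColoring {V : Type*} {G : SimpleGraph V}
    {l : Sym2 V → ℤˣ} {r : ℝ} (hr : 0 < r) {f : V → AddCircle r}
    (hf : IsSignedCircularColoring G (fun e => l e) r f) {k M : ℕ} (hM : 0 < M)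
    (hkM : 1 / (k : ℝ) + 2 / M ≤ 2 / r) :
    ∃ c : V → Fin M, IsLabelledColoring (discreteSignedConstraint k M) G l c := by
  have hM0 : (0 : ℝ) < M := by exact_mod_cast hM
  choose y hy using fun v => QuotientAddGroup.mk_surjective (f v)
  set x : V → ℝ := fun v => Int.fract (y v / r) with hx
  have hxy : ∀ v, y v = (x v + ⌊y v / r⌋) * r := fun v => by
    rw [hx, Int.fract_add_floor, div_mul_cancel₀ _ hr.ne']
  have hx0 : ∀ v, 0 ≤ M * x v := fun v => mul_nonneg hM0.le (Int.fract_nonneg _)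
  refine ⟨fun v => ⟨⌊M * x v⌋₊, (Nat.floor_lt (hx0 v)).mpr
    (mul_lt_of_lt_one_right hM0 (Int.fract_lt_one _))⟩, fun u v huv n hn => ?_⟩
  have hround : ∀ v, 2 * (⌊M * x v⌋₊ : ℝ) / M ≤ 2 * x v ∧
      2 * x v < 2 * (⌊M * x v⌋₊ : ℝ) / M + 2 / M := fun v => by
    have h1 := Nat.floor_le (hx0 v)
    have h2 := Nat.lt_floor_add_one (M * x v)
    rw [← add_div, div_le_iff₀ hM0, lt_div_iff₀ hM0]
    constructor <;> linarith
  -- lengths are multiplied by `2 / r`, so that the half turn becomes `1`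
  have hfar : 2 / r ≤ |2 * x u - 2 * x v - n| := by
    obtain ⟨h1, h2⟩ := hf u v huv
    rw [← hy u, ← hy v] at h1 h2
    have hscale : |2 * x u - 2 * x v - n| =
        2 * |y u - y v - ((⌊y u / r⌋ - ⌊y v / r⌋ : ℝ) + n / 2) * r| / r := by
      rw [show y u - y v - ((⌊y u / r⌋ - ⌊y v / r⌋ : ℝ) + n / 2) * r =
        (2 * x u - 2 * x v - n) * (r / 2) by linear_combination hxy u - hxy v, abs_mul,
        abs_of_pos (half_pos hr)]
      field_simp
    rw [hscale, div_le_div_iff_of_pos_right hr]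
    rcases Int.even_or_odd' n with ⟨m, rfl | rfl⟩
    · have h := (AddCircle.one_le_dist_iff hr _ _).mp (h1 (hn.mpr (by simp)))
        (⌊y u / r⌋ - ⌊y v / r⌋ + m)
      push_cast at h ⊢
      rw [show (2 * (m : ℝ)) / 2 = m by ring]
      linarith
    · have hs : l s(u, v) = -1 :=
        (Int.units_eq_one_or _).resolve_left fun h =>
          Int.not_even_two_mul_add_one m (hn.mp h)
      have h := (AddCircle.one_le_dist_antipodal_iff hr _ _).mp (h2 hs)
        (⌊y u / r⌋ - ⌊y v / r⌋ + m)
      push_cast at h ⊢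
      rw [show (⌊y u / r⌋ - ⌊y v / r⌋ : ℝ) + (2 * (m : ℝ) + 1) / 2 =
        ⌊y u / r⌋ - ⌊y v / r⌋ + m + 1 / 2 by ring]
      linarith
  obtain ⟨hu1, hu2⟩ := hround u
  obtain ⟨hv1, hv2⟩ := hround v
  have htri : |2 * x u - 2 * x v - n| <
      |2 * (⌊M * x u⌋₊ : ℝ) / M - 2 * (⌊M * x v⌋₊ : ℝ) / M - n| + 2 / M := by
    rw [abs_lt]
    constructor
    · linarith [neg_abs_le (2 * (⌊M * x u⌋₊ : ℝ) / M - 2 * (⌊M * x v⌋₊ : ℝ) / M - n)]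
    · linarith [le_abs_self (2 * (⌊M * x u⌋₊ : ℝ) / M - 2 * (⌊M * x v⌋₊ : ℝ) / M - n)]
  change _ < |2 * (⌊M * x u⌋₊ : ℝ) / M - 2 * (⌊M * x v⌋₊ : ℝ) / M - n|
  linarith

/-- The labelled graph without compatible colourings, for signs as labels and grid points as
colours, has signed circular chromatic number close to `2 * k`. -/
theorem exists_colorable_lt_signedCircularChromaticNumber {k : ℕ} (hk : 2 ≤ k) (g : ℕ) {ε : ℝ}
    (hε : 0 < ε) (hε2 : ε ≤ 2) :
    ∃ (V : Type) (_ : Fintype V) (G : SimpleGraph V),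
      (g : ℕ∞) ≤ G.egirth ∧ G.Colorable k ∧ 2 * (k : ℝ) - ε < signedCircularChromaticNumber G := by
  have hk2 : (2 : ℝ) ≤ k := by exact_mod_cast hk
  have hgap : 0 < 2 / (2 * (k : ℝ) - ε / 2) - 1 / k := by
    rw [sub_pos, div_lt_div_iff₀ (by linarith) (by linarith)]
    linarith
  -- `M` is so large that rounding to the grid costs less than this gap
  obtain ⟨M, hM⟩ := exists_nat_gt (2 / (2 / (2 * (k : ℝ) - ε / 2) - 1 / k))
  have hM0 : (0 : ℝ) < M := lt_trans (by positivity) hM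
  have : Nonempty (Fin M) := ⟨⟨0, by exact_mod_cast hM0⟩⟩
  obtain ⟨V, hV, G, l, hgirth, hcol, hno⟩ := exists_labelled_graph_of_large_girth (by omega) g
    (discreteSignedConstraint k M) (exists_ne_not_discreteSignedConstraint hk M)
  refine ⟨V, hV, G, hgirth, hcol, ?_⟩
  let σ : Signature G := fun e => l e
  calc 2 * (k : ℝ) - ε < 2 * k - ε / 2 := by linarith
    _ ≤ signedGraphCircularChromaticNumber G σ := ?_
    _ ≤ signedCircularChromaticNumber G :=
      (isGreatest_signedCircularChromaticNumber G).2 ⟨σ, rfl⟩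
  obtain ⟨f, hf⟩ := hcol.exists_isCircularColoring (by omega)
  refine le_csInf
    ⟨2 * k, by linarith, hf.exists_isSignedCircularColoring (by linarith) σ⟩ ?_
  rintro r ⟨hr, f, hf⟩
  by_contra! hlt
  obtain ⟨c, hc⟩ := hf.exists_isLabelledColoring (l := l) (k := k) (M := M) (by linarith)
    (by exact_mod_cast hM0) (by
      rw [div_lt_comm₀ hgap hM0] at hM
      have : 2 / (2 * (k : ℝ) - ε / 2) ≤ 2 / r :=
        div_le_div_of_nonneg_left two_pos.le (by linarith) hlt.le
      linarith)
  exact hno c hc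

theorem mainTheorem2 (k g : ℕ) (hk : 2 ≤ k) (hg : 2 ≤ g) (ε : ℝ) (hε : 0 < ε) :
    ∃ (V : Type) (_ : Fintype V) (G : SimpleGraph V),
      (g : ℕ∞) ≤ G.egirth ∧
      G.chromaticNumber = (k : ℕ∞) ∧
      2 * (k : ℝ) - ε < signedCircularChromaticNumber G ∧
      2 * circularChromaticNumber G - ε < signedCircularChromaticNumber G ∧
      signedCircularChromaticNumber G ≤ 2 * circularChromaticNumber G := by
  obtain ⟨V, hV, G, hgirth, hcol, hlow⟩ := exists_colorable_lt_signedCircularChromaticNumber hk g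
    (ε := min ε 2) (by positivity) (min_le_right _ _)
  have hup := signedCircularChromaticNumber_le G (by omega) hcol
  have hck := circularChromaticNumber_le_of_colorable (by omega) hcol
  have hε1 := min_le_left ε 2
  have hε2 := min_le_right ε 2
  refine ⟨V, hV, G, hgirth, le_antisymm hcol.chromaticNumber_le ?_, by linarith, by linarith, hup⟩
  -- a colouring with `k - 1` colours would give the upper bound `2 * (k - 1)`
  by_contra! hlt
  have hcol' : G.Colorable (k - 1) := by
    rw [← SimpleGraph.chromaticNumber_le_iff_colorable]
    exact Order.le_of_lt_add_one (hlt.trans_le (by exact_mod_cast (by omega : k ≤ k - 1 + 1)))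
  have h := circularChromaticNumber_le_of_colorable (by omega) hcol'
  rw [Nat.cast_sub (by omega), Nat.cast_one] at h
  linarith
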